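/- Let $0<\underline{\sigma}\le\overline{\sigma}<\infty$ and let $\phi(z)=\frac{1}{\sqrt{2\pi}}e^{-z^2/2}$. Put $$f(y)=\frac{2}{\overline{\sigma}+\underline{\sigma}}\int_{-y}^{\infty}\bigl\{\phi(z/\overline{\sigma})\mathbf 1_{\{z\ge 0\}}+\phi(z/\underline{\sigma})\mathbf 1_{\{z<0\}}\bigr\}\,dz .$$ For $c>\overline{\sigma}/2$, $t>0$ and $x\in\mathbb R$ let $u(t,x)=f\bigl((x-c)/\sqrt t\bigr)$ and $v(t,x)=f\bigl((-x-c)/\sqrt t\bigr)$, and put $u(0,x)=\mathbf 1_{\{x>c\}}$, $v(0,x)=\mathbf 1_{\{x<-c\}}$. Let $w:[0,\infty)\times\mathbb R\to\mathbb R$ be the bounded viscosity solution of the Cauchy problem $$w_t=\tfrac12\bigl(\overline{\sigma}^2(w_{xx})^+-\underline{\sigma}^2(w_{xx})^-\bigr)\quad\text{on }(0,\infty)\times\mathbb R,\qquad w(0,x)=\mathbf 1_{\{|x|>c\}},$$ where $a^+=\max(a,0)$ and $a^-=\max(-a,0)$, and where "solution" includes that $w$ is continuous on $(0,\infty)\times\mathbb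 R$ and, as a function on $[0,\infty)\times\mathbb R$, at every point $(0,x)$ with $|x|\ne c$. Then $u(0,x)+v(0,x)-w(0,x)=0$ for all $x\in\mathbb R$, and for all $t>0$ and $x\in\mathbb R$ one has $$0\le u(t,x)+v(t,x)-w(t,x)\le\frac{(\overline{\sigma}-\underline{\sigma})\sqrt t}{c\sqrt{2\pi}}\exp\Bigl(-\frac{2c^2}{\overline{\sigma}^2t}\Bigr),$$ $u(t,x)+v(t,x)>0$, and $$0\le\frac{u(t,x)+v(t,x)-w(t,x)}{u(t,x)+v(t,x)}\le\frac{(\overline{\sigma}^2-\underline{\sigma}^2)(c^2/\overline{\sigma}^2+t)}{4c^2}\exp\Bigl(-\frac{3c^2}{2\overline{\sigma}^2t}\Bigr).$$ -/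

import Mathlib

open Set MeasureTheory

namespace GHeat

/-- The density `φ` of the standard normal distribution. -/
noncomputable def stdPDF (z : ℝ) : ℝ := ProbabilityTheory.gaussianPDFReal 0 1 z

/-- The nonlinearity `G(a) = (σu² a⁺ - σl² a⁻) / 2` of the G-heat equation, where
`σl` is the lower and `σu` the upper standard deviation. -/
noncomputable def G (σl σu a : ℝ) : ℝ := (σu ^ 2 * max a 0 - σl ^ 2 * max (-a) 0) / 2

/-- `w` is a viscosity subsolution of `w_t = G(w_xx)` on `(0, ∞) × ℝ`: whenever `ψ` is of class
`C²` near a point `(t, x)` with `t > 0` and `w - ψ` has a local maximum there,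
`ψ_t ≤ G(ψ_xx)` at that point. -/
def IsViscositySubsolution (σl σu : ℝ) (w : ℝ → ℝ → ℝ) : Prop :=
  ∀ (t x : ℝ) (ψ : ℝ × ℝ → ℝ), 0 < t → ContDiffAt ℝ 2 ψ (t, x) →
    IsLocalMax (fun p : ℝ × ℝ => w p.1 p.2 - ψ p) (t, x) →
    deriv (fun s => ψ (s, x)) t ≤ G σl σu (iteratedDeriv 2 (fun y => ψ (t, y)) x)

/-- `w` is a viscosity supersolution of `w_t = G(w_xx)` on `(0, ∞) × ℝ`: whenever `ψ` is of class
`C²` near a point `(t, x)` with `t > 0` and `w - ψ` has a local minimum there,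
`ψ_t ≥ G(ψ_xx)` at that point. -/
def IsViscositySupersolution (σl σu : ℝ) (w : ℝ → ℝ → ℝ) : Prop :=
  ∀ (t x : ℝ) (ψ : ℝ × ℝ → ℝ), 0 < t → ContDiffAt ℝ 2 ψ (t, x) →
    IsLocalMin (fun p : ℝ × ℝ => w p.1 p.2 - ψ p) (t, x) →
    G σl σu (iteratedDeriv 2 (fun y => ψ (t, y)) x) ≤ deriv (fun s => ψ (s, x)) t

/-- `w` (restricted to `[0, ∞) × ℝ`) is a bounded viscosity solution of the Cauchy problem
`w_t = G(w_xx)`, `w(0, ·) = g`. The datum `g` may be discontinuous: `w` is continuous on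
`(0, ∞) × ℝ` and attains `g` continuously at every continuity point of `g`. -/
structure IsSolution (σl σu : ℝ) (g : ℝ → ℝ) (w : ℝ → ℝ → ℝ) : Prop where
  continuousOn : ContinuousOn (fun p : ℝ × ℝ => w p.1 p.2) (Ioi 0 ×ˢ univ)
  bounded : ∃ M : ℝ, ∀ t x : ℝ, 0 ≤ t → |w t x| ≤ M
  subsolution : IsViscositySubsolution σl σu w
  supersolution : IsViscositySupersolution σl σu w
  initial : ∀ x : ℝ, w 0 x = g x
  initial_continuous : ∀ x : ℝ, ContinuousAt g x →
    ContinuousWithinAt (fun p : ℝ × ℝ => w p.1 p.2) (Ici 0 ×ˢ univ) (0, x)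

/-- The profile
`f(y) = 2 / (σu + σl) * ∫_{-y}^∞ (φ(z/σu) 1_{z ≥ 0} + φ(z/σl) 1_{z < 0}) dz`. -/
noncomputable def profile (σl σu y : ℝ) : ℝ :=
  2 / (σu + σl) * ∫ z in Ioi (-y), if 0 ≤ z then stdPDF (z / σu) else stdPDF (z / σl)

/-- `u(t, x) = f((x - c) / √t)` for `t > 0`, with the initial value `u(0, x) = 1_{x > c}`. -/
noncomputable def u (σl σu c t x : ℝ) : ℝ :=
  if t = 0 then indicator {y : ℝ | c < y} 1 x else profile σl σu ((x - c) / √t)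

/-- `v(t, x) = f((-x - c) / √t)` for `t > 0`, with the initial value `v(0, x) = 1_{x < -c}`. -/
noncomputable def v (σl σu c t x : ℝ) : ℝ :=
  if t = 0 then indicator {y : ℝ | y < -c} 1 x else profile σl σu ((-x - c) / √t)

end GHeat

/-! Each of `u`, `v` is a classical self-similar solution: `f` is convex on `y ≤ 0` and concave on
`y ≥ 0`, and the variance of its Gaussian density on each side is the one that `G` selects for that
sign. Since `G` is subadditive, `u + v` is a supersolution, and comparison gives `w ≤ u + v`.

For the lower bound, let `a = u_xx`, `b = v_xx`. The defect `G a + G b - G (a + b)` vanishes for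
`|x| ≤ c`, where both waves are convex. Beyond `c` it is at most `(σu² - σl²)/2 · b`, and there `v`
is seen at distance at least `2c` from its front, so this is a Gaussian tail (symmetrically below
`-c`). The function `errBound` has time derivative dominating that tail, so `u + v - errBound` is a
subsolution and lies below `w`.

For the relative error, convexity and a Mills ratio bound give a lower bound for `u + v` of order
`φ(p) p / (1 + p²)`, `p = c / (σu √t)`, and `φ(2p) = exp(-3p²/2) φ(p)`.

Comparison is always between a viscosity function and a classical one, so no doubling of variables
is needed. The jumps at `±c` are absorbed by vanishing Gaussian barriers. -/

open Filter Topology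

namespace GHeat

/-! ### The nonlinearity and classical supersolutions -/

/-- Viscosity subsolutions of `w_t = F(w_xx)` on `(0, ∞) × ℝ` for a general nonlinearity `F`. -/
def IsSubsolutionOf (F : ℝ → ℝ) (w : ℝ → ℝ → ℝ) : Prop :=
  ∀ (t x : ℝ) (ψ : ℝ × ℝ → ℝ), 0 < t → ContDiffAt ℝ 2 ψ (t, x) →
    IsLocalMax (fun p : ℝ × ℝ => w p.1 p.2 - ψ p) (t, x) →
    deriv (fun s => ψ (s, x)) t ≤ F (iteratedDeriv 2 (fun y => ψ (t, y)) x)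

lemma IsViscositySubsolution.isSubsolutionOf {σl σu : ℝ} {w : ℝ → ℝ → ℝ}
    (h : IsViscositySubsolution σl σu w) : IsSubsolutionOf (G σl σu) w := h

/-- Turns lower bounds for `w` into upper bounds for `-w`, so that one comparison theorem, stated
for general `F`, serves both directions. -/
lemma IsViscositySupersolution.isSubsolutionOf_neg {σl σu : ℝ} {w : ℝ → ℝ → ℝ}
    (h : IsViscositySupersolution σl σu w) :
    IsSubsolutionOf (fun a => -G σl σu (-a)) (fun t x => -w t x) := by
  intro t x ψ ht hψ hmax
  have h1 := h t x (fun p => -ψ p) ht hψ.neg (by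
    have := hmax.neg
    refine this.congr (Eventually.of_forall fun p => ?_)
    simp only []
    ring)
  have e1 : deriv (fun s => -ψ (s, x)) t = -deriv (fun s => ψ (s, x)) t := deriv.fun_neg
  have e2 : iteratedDeriv 2 (fun y => -ψ (t, y)) x = -iteratedDeriv 2 (fun y => ψ (t, y)) x :=
    iteratedDeriv_fun_neg 2 _ x
  rw [e1, e2] at h1
  simp only []
  linarith

lemma G_eq_of_nonneg {σl σu a : ℝ} (ha : 0 ≤ a) : G σl σu a = σu ^ 2 * a / 2 := by
  rw [G, max_eq_left ha, max_eq_right (by linarith)]; ring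

lemma G_eq_of_nonpos {σl σu a : ℝ} (ha : a ≤ 0) : G σl σu a = σl ^ 2 * a / 2 := by
  rw [G, max_eq_right ha, max_eq_left (by linarith)]; ring

/-- `G a` is the supremum of `s a / 2` over `s ∈ [σl², σu²]`, hence sublinear. -/
lemma G_add_le {σl σu : ℝ} (hσl : 0 ≤ σl) (hσ : σl ≤ σu) (a b : ℝ) :
    G σl σu (a + b) ≤ G σl σu a + G σl σu b := by
  have h : σl ^ 2 ≤ σu ^ 2 := by gcongr
  rcases le_total 0 a with ha | ha <;> rcases le_total 0 b with hb | hb <;>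
    rcases le_total 0 (a + b) with hab | hab <;>
    simp only [G_eq_of_nonneg, G_eq_of_nonpos, ha, hb, hab] <;>
    nlinarith [mul_nonneg (sub_nonneg.2 h) (abs_nonneg a), mul_nonneg (sub_nonneg.2 h) (abs_nonneg b),
      le_abs_self a, neg_le_abs a, le_abs_self b, neg_le_abs b]

/-- `P` is of class `C²` near `p` and satisfies `P_t ≥ F(P_xx)` at `p`. -/
structure IsSuperAt (F : ℝ → ℝ) (P : ℝ × ℝ → ℝ) (p : ℝ × ℝ) : Prop where
  contDiffAt : ContDiffAt ℝ 2 P p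
  le : F (iteratedDeriv 2 (fun y => P (p.1, y)) p.2) ≤ deriv (fun s => P (s, p.2)) p.1

lemma contDiffAt_slice_snd {P : ℝ × ℝ → ℝ} {p : ℝ × ℝ} (h : ContDiffAt ℝ 2 P p) :
    ContDiffAt ℝ 2 (fun y => P (p.1, y)) p.2 :=
  ContDiffAt.comp (f := fun y : ℝ => (p.1, y)) p.2 h (by fun_prop)

lemma contDiffAt_slice_fst {P : ℝ × ℝ → ℝ} {p : ℝ × ℝ} (h : ContDiffAt ℝ 2 P p) :
    ContDiffAt ℝ 2 (fun s => P (s, p.2)) p.1 :=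
  ContDiffAt.comp (f := fun s : ℝ => (s, p.2)) p.1 h (by fun_prop)

lemma iteratedDeriv_two_slice_add {P Q : ℝ × ℝ → ℝ} {p : ℝ × ℝ} (hP : ContDiffAt ℝ 2 P p)
    (hQ : ContDiffAt ℝ 2 Q p) :
    iteratedDeriv 2 (fun y => P (p.1, y) + Q (p.1, y)) p.2 =
      iteratedDeriv 2 (fun y => P (p.1, y)) p.2 + iteratedDeriv 2 (fun y => Q (p.1, y)) p.2 :=
  iteratedDeriv_fun_add (contDiffAt_slice_snd hP) (contDiffAt_slice_snd hQ)

lemma deriv_slice_add {P Q : ℝ × ℝ → ℝ} {p : ℝ × ℝ} (hP : ContDiffAt ℝ 2 P p)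
    (hQ : ContDiffAt ℝ 2 Q p) :
    deriv (fun s => P (s, p.2) + Q (s, p.2)) p.1 =
      deriv (fun s => P (s, p.2)) p.1 + deriv (fun s => Q (s, p.2)) p.1 :=
  deriv_fun_add ((contDiffAt_slice_fst hP).differentiableAt (by norm_num))
    ((contDiffAt_slice_fst hQ).differentiableAt (by norm_num))

lemma IsSuperAt.add {F H : ℝ → ℝ} (hFH : ∀ a b, F (a + b) ≤ F a + H b) {P Q : ℝ × ℝ → ℝ}
    {p : ℝ × ℝ} (hP : IsSuperAt F P p) (hQ : IsSuperAt H Q p) :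
    IsSuperAt F (fun q => P q + Q q) p where
  contDiffAt := hP.contDiffAt.add hQ.contDiffAt
  le := by
    rw [iteratedDeriv_two_slice_add hP.contDiffAt hQ.contDiffAt,
      deriv_slice_add hP.contDiffAt hQ.contDiffAt]
    exact (hFH _ _).trans (add_le_add hP.le hQ.le)

lemma iteratedDeriv_two_eq {g g' : ℝ → ℝ} {x b : ℝ} (h1 : ∀ᶠ y in 𝓝 x, HasDerivAt g (g' y) y)
    (h2 : HasDerivAt g' b x) : iteratedDeriv 2 g x = b := by
  rw [iteratedDeriv_succ, iteratedDeriv_one]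
  rw [EventuallyEq.deriv_eq (h1.mono fun y hy => hy.deriv : deriv g =ᶠ[𝓝 x] g')]
  exact h2.deriv

/-! ### Comparison with classical supersolutions -/

/-- Comparison principle between a bounded viscosity subsolution and a classical supersolution
which dominates it initially. -/
theorem le_of_isSubsolutionOf {σl σu : ℝ} {F : ℝ → ℝ}
    (hF : ∀ a b, F (a + b) ≤ F a + G σl σu b) {w : ℝ → ℝ → ℝ} {M : ℝ}
    (hcont : ContinuousOn (fun p : ℝ × ℝ => w p.1 p.2) (Ioi 0 ×ˢ univ))
    (hsub : IsSubsolutionOf F w) {P : ℝ × ℝ → ℝ}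
    (hP : ∀ p : ℝ × ℝ, 0 < p.1 → IsSuperAt F P p)
    (hM : ∀ t x : ℝ, 0 < t → w t x - P (t, x) ≤ M)
    (hinit : ∀ x ε : ℝ, 0 < ε → ∀ᶠ p in 𝓝[Ioi 0 ×ˢ univ] ((0 : ℝ), x), w p.1 p.2 ≤ P p + ε)
    {t₀ x₀ : ℝ} (ht₀ : 0 < t₀) : w t₀ x₀ ≤ P (t₀, x₀) := by
  by_contra! hlt
  set θ := w t₀ x₀ - P (t₀, x₀) with hθ
  have hθ0 : 0 < θ := by rw [hθ]; linarith
  obtain ⟨ε, hε, hε1⟩ : ∃ ε > 0, ε * (x₀ ^ 2 + σu ^ 2 * t₀) ≤ θ / 4 := by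
    refine ⟨θ / 4 / (x₀ ^ 2 + σu ^ 2 * t₀ + 1), by positivity, ?_⟩
    rw [div_mul_eq_mul_div, div_le_iff₀ (by positivity)]
    nlinarith
  set T := t₀ + 1 with hT
  set η := θ / 4 with hη
  have hη0 : 0 < η := by positivity
  -- The first term solves the equation exactly, as `G (2ε) = ε σu²`, and confines the maximum in
  -- space. The second blows up at `T` and is strictly increasing in time. Since `T - t₀ = 1`, their
  -- total at `(t₀, x₀)` is at most `θ / 2`.
  let R : ℝ × ℝ → ℝ := fun p => ε * (p.2 ^ 2 + σu ^ 2 * p.1) + η * (T - p.1)⁻¹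
  let h : ℝ × ℝ → ℝ := fun p => w p.1 p.2 - (P p + R p)
  have hh0 : θ / 2 ≤ h (t₀, x₀) := by
    have e : R (t₀, x₀) = ε * (x₀ ^ 2 + σu ^ 2 * t₀) + η := by simp [R, hT]
    simp only [h, e]; linarith
  have hR : ∀ p : ℝ × ℝ, 0 < p.1 → p.1 < T → 0 ≤ R p := fun p h1 h2 => by
    have := sub_pos.2 h2
    simp only [R]; positivity
  -- away from a compact box the function `h` is small
  obtain ⟨r, hr0, hr⟩ : ∃ r : ℝ, |x₀| < r ∧ M < ε * r ^ 2 := by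
    have h1 : Tendsto (fun r : ℝ => ε * r ^ 2) atTop atTop :=
      (tendsto_pow_atTop two_ne_zero).const_mul_atTop hε
    exact ((eventually_gt_atTop |x₀|).and (h1.eventually_gt_atTop M)).exists
  have hside : ∀ p : ℝ × ℝ, 0 < p.1 → p.1 < T → r ≤ |p.2| → h p < θ / 2 := by
    intro p h1 h2 h3
    have h4 := hM p.1 p.2 h1
    have h5 : r ^ 2 ≤ p.2 ^ 2 := by
      rw [← sq_abs p.2]; exact pow_le_pow_left₀ ((abs_nonneg _).trans hr0.le) h3 2
    have h6 : 0 ≤ η * (T - p.1)⁻¹ := by have := sub_pos.2 h2; positivity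
    have h7 : ε * r ^ 2 ≤ ε * p.2 ^ 2 := by gcongr
    have h8 : 0 ≤ ε * (σu ^ 2 * p.1) := by positivity
    simp only [h, R]
    linarith
  obtain ⟨t₁, ht₁, hbot⟩ : ∃ t₁ > 0, ∀ t : ℝ, 0 < t → t < T → t ≤ t₁ → ∀ x ∈ Icc (-r) r,
      h (t, x) < θ / 2 := by
    -- Compactness makes the pointwise initial ordering uniform over `|x| ≤ r`.
    have h1 : ∀ᶠ t in 𝓝 (0 : ℝ), ∀ x ∈ Icc (-r) r, 0 < t → w t x ≤ P (t, x) + θ / 4 := by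
      refine isCompact_Icc.eventually_forall_of_forall_eventually (fun x _ => ?_)
      have := hinit x (θ / 4) (by positivity)
      rw [eventually_nhdsWithin_iff] at this
      exact this.mono fun p hp h1 => hp ⟨h1, mem_univ _⟩
    obtain ⟨t₁, ht₁, H⟩ := Metric.eventually_nhds_iff.1 h1
    refine ⟨t₁ / 2, by positivity, fun t h2 h3 h4 x hx => ?_⟩
    have h5 := H (y := t) (by rw [Real.dist_eq, sub_zero, abs_of_pos h2]; linarith) x hx h2
    have h6 := hR (t, x) h2 h3
    simp only [h]
    linarith
  obtain ⟨t₂, ht₂, htop⟩ : ∃ t₂ < T, ∀ p : ℝ × ℝ, 0 < p.1 → p.1 < T → t₂ ≤ p.1 →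
      h p < θ / 2 := by
    refine ⟨T - η / (|M| + 1), by linarith [show 0 < η / (|M| + 1) by positivity],
      fun p h1 h2 h3 => ?_⟩
    have h4 := hM p.1 p.2 h1
    have h0 := sub_pos.2 h2
    have h5 : |M| + 1 ≤ η * (T - p.1)⁻¹ := by
      rw [← div_eq_mul_inv, le_div_iff₀ h0]
      have : T - p.1 ≤ η / (|M| + 1) := by linarith
      rw [le_div_iff₀ (by positivity)] at this
      linarith
    have h6 : 0 ≤ ε * (p.2 ^ 2 + σu ^ 2 * p.1) := by positivity
    simp only [h, R]
    linarith [le_abs_self M]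
  have hcontP : ContinuousOn P (Ioi 0 ×ˢ univ) := fun p hp =>
    (hP p hp.1).contDiffAt.continuousAt.continuousWithinAt
  have hK : IsCompact (Icc t₁ t₂ ×ˢ Icc (-r) r) := isCompact_Icc.prod isCompact_Icc
  have hKs : Icc t₁ t₂ ×ˢ Icc (-r) r ⊆ Ioi (0 : ℝ) ×ˢ univ := fun p hp =>
    ⟨ht₁.trans_le hp.1.1, mem_univ _⟩
  have hhc : ContinuousOn h (Icc t₁ t₂ ×ˢ Icc (-r) r) := by
    refine (hcont.mono hKs).sub ((hcontP.mono hKs).add ?_)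
    refine ContinuousOn.add (by fun_prop) (continuousOn_const.mul (ContinuousOn.inv₀ (by fun_prop) ?_))
    intro p hp
    have := hp.1.2
    exact (by linarith : 0 < T - p.1).ne'
  -- Points with `h ≥ θ / 2` lie in the open box, so the maximum over the closed box is a genuine
  -- local maximum.
  have hmem : ∀ p : ℝ × ℝ, 0 < p.1 → p.1 < T → θ / 2 ≤ h p →
      p ∈ Ioo t₁ t₂ ×ˢ Ioo (-r) r := by
    intro p h1 h2 h3
    have h4 : |p.2| < r := by
      by_contra! hc; exact (hside p h1 h2 hc).not_ge h3
    have h4' := abs_lt.1 h4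
    refine ⟨⟨?_, ?_⟩, h4'⟩
    · by_contra! hc; exact (hbot p.1 h1 h2 hc p.2 ⟨h4'.1.le, h4'.2.le⟩).not_ge h3
    · by_contra! hc; exact (htop p h1 h2 hc).not_ge h3
  have hp0 := hmem (t₀, x₀) ht₀ (by simp [hT]) hh0
  have hss : Ioo t₁ t₂ ×ˢ Ioo (-r) r ⊆ Icc t₁ t₂ ×ˢ Icc (-r) r :=
    prod_mono Ioo_subset_Icc_self Ioo_subset_Icc_self
  obtain ⟨⟨t, x⟩, hpK, hpmax⟩ := hK.exists_isMaxOn ⟨_, hss hp0⟩ hhc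
  have hpt : 0 < t := ht₁.trans_le hpK.1.1
  have hptT : t < T := lt_of_le_of_lt hpK.1.2 ht₂
  have hpin := hmem (t, x) hpt hptT (hh0.trans (hpmax (hss hp0)))
  have hloc : IsLocalMax h (t, x) :=
    hpmax.isLocalMax (mem_of_superset ((isOpen_Ioo.prod isOpen_Ioo).mem_nhds hpin) hss)
  have hTt : T - t ≠ 0 := (sub_pos.2 hptT).ne'
  have hRc : ContDiffAt ℝ 2 R (t, x) := by
    refine ContDiffAt.add (by fun_prop) (contDiffAt_const.mul (ContDiffAt.inv (by fun_prop) hTt))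
  have hPt := hP (t, x) hpt
  -- `P + R` is itself the test function; the surplus `η / (T - t)²` in its time derivative
  -- contradicts the subsolution inequality.
  have key := hsub t x (fun p => P p + R p) hpt (hPt.contDiffAt.add hRc) hloc
  have e1 := iteratedDeriv_two_slice_add hPt.contDiffAt hRc
  have e2 := deriv_slice_add hPt.contDiffAt hRc
  simp only at e1 e2 key
  have e3 : iteratedDeriv 2 (fun y => R (t, y)) x = 2 * ε := by
    refine iteratedDeriv_two_eq (g' := fun y => 2 * ε * y) (Eventually.of_forall fun y => ?_) ?_
    · have := ((((hasDerivAt_id y).pow 2).add_const (σu ^ 2 * t)).const_mul ε).add_const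
        (η * (T - t)⁻¹)
      refine this.congr_deriv ?_
      simp; ring
    · simpa using (hasDerivAt_id x).const_mul (2 * ε)
  have e4 : deriv (fun s => R (s, x)) t = ε * σu ^ 2 + η * ((T - t) ^ 2)⁻¹ := by
    have h1 := ((((hasDerivAt_id t).const_mul (σu ^ 2)).const_add (x ^ 2)).const_mul ε).add
      ((((hasDerivAt_id t).const_sub T).inv hTt).const_mul η)
    refine (h1.congr_deriv ?_).deriv
    simp [div_eq_mul_inv]
  rw [e1, e2, e3, e4] at key
  have h1 := hF (iteratedDeriv 2 (fun y => P (t, y)) x) (2 * ε)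
  rw [G_eq_of_nonneg (by positivity)] at h1
  have h2 := hPt.le
  have h3 : 0 < η * ((T - t) ^ 2)⁻¹ := by positivity
  simp only at h2
  linarith

/-! ### Barriers for exceptional initial points -/

/-- A positive multiple of a spreading Gaussian, a classical supersolution of the G-heat equation
that is at least `k` at `(0, z)` and vanishes at positive times as `δ → 0`. -/
noncomputable def barrier (σl σu k δ z : ℝ) (p : ℝ × ℝ) : ℝ :=
  k * Real.exp (σl ^ 2 / (2 * σu ^ 2) * (Real.log δ - Real.log (p.1 + δ)) -
    (p.2 - z) ^ 2 / (2 * σu ^ 2 * (p.1 + δ)))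

lemma barrier_nonneg {σl σu k δ z : ℝ} (hk : 0 ≤ k) (p : ℝ × ℝ) : 0 ≤ barrier σl σu k δ z p := by
  unfold barrier; positivity

lemma contDiffAt_barrier {σl σu k δ z : ℝ} (hσu : 0 < σu) {p : ℝ × ℝ} (hp : 0 < p.1 + δ) :
    ContDiffAt ℝ 2 (barrier σl σu k δ z) p := by
  unfold barrier
  refine contDiffAt_const.mul (ContDiffAt.exp (ContDiffAt.sub (contDiffAt_const.mul
    (contDiffAt_const.sub (ContDiffAt.log (by fun_prop) hp.ne'))) ?_))
  exact ContDiffAt.div (by fun_prop) (by fun_prop) (by positivity)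

/-- With `q = (x - z)² / (σu² (t + δ))` and a common factor `m ≥ 0`, the second space derivative is
`m (q - 1)` and the time derivative `m (σu² q - σl²) / 2`. The slow decay exponent `σl² / (2σu²)` is
what makes the inequality hold for both signs of `q - 1`. -/
lemma barrier_isSuperAt {σl σu k δ z : ℝ} (hσl : 0 < σl) (hσ : σl ≤ σu) (hk : 0 ≤ k) (hδ : 0 < δ)
    {p : ℝ × ℝ} (hp : 0 < p.1) : IsSuperAt (G σl σu) (barrier σl σu k δ z) p := by
  obtain ⟨t, x⟩ := p
  have hσu : 0 < σu := hσl.trans_le hσ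
  have ht : 0 < t + δ := by simp only at hp; linarith
  refine ⟨contDiffAt_barrier hσu ht, ?_⟩
  simp only
  set K := barrier σl σu k δ z (t, x) with hK
  have hK0 : 0 ≤ K := barrier_nonneg hk _
  have hx : ∀ y, HasDerivAt (fun y => barrier σl σu k δ z (t, y))
      (barrier σl σu k δ z (t, y) * (-(y - z) / (σu ^ 2 * (t + δ)))) y := by
    intro y
    have h1 := (((((hasDerivAt_id y).sub_const z).pow 2).div_const
      (2 * σu ^ 2 * (t + δ))).const_sub
      (σl ^ 2 / (2 * σu ^ 2) * (Real.log δ - Real.log (t + δ)))).exp.const_mul k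
    refine h1.congr_deriv ?_
    simp [barrier]; field_simp; ring
  have e1 : iteratedDeriv 2 (fun y => barrier σl σu k δ z (t, y)) x =
      K * ((x - z) ^ 2 / (σu ^ 4 * (t + δ) ^ 2) - 1 / (σu ^ 2 * (t + δ))) := by
    refine iteratedDeriv_two_eq (Eventually.of_forall hx) ?_
    have h2 := (hx x).mul ((((hasDerivAt_id x).sub_const z).neg).div_const (σu ^ 2 * (t + δ)))
    refine h2.congr_deriv ?_
    simp only [← hK, id, Pi.neg_apply]
    field_simp; ring
  have e2 : deriv (fun s => barrier σl σu k δ z (s, x)) t =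
      K * (-(σl ^ 2 / (2 * σu ^ 2)) / (t + δ) + (x - z) ^ 2 / (2 * σu ^ 2 * (t + δ) ^ 2)) := by
    have h0 : HasDerivAt (fun s => s + δ) 1 t := (hasDerivAt_id t).add_const δ
    have h1 := ((((h0.log ht.ne').const_sub (Real.log δ)).const_mul (σl ^ 2 / (2 * σu ^ 2))).sub
      ((hasDerivAt_const t ((x - z) ^ 2)).div (h0.const_mul (2 * σu ^ 2))
        (by positivity))).exp.const_mul k
    refine (h1.congr_deriv ?_).deriv
    simp only [hK, barrier, Pi.div_apply, Pi.sub_apply]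
    field_simp; ring
  rw [e1, e2]
  have h : σl ^ 2 ≤ σu ^ 2 := by gcongr
  set q := (x - z) ^ 2 / (σu ^ 2 * (t + δ)) with hq
  have hq0 : 0 ≤ q := by positivity
  set m := K / (σu ^ 2 * (t + δ)) with hm
  have hm0 : 0 ≤ m := by positivity
  have e3 : K * ((x - z) ^ 2 / (σu ^ 4 * (t + δ) ^ 2) - 1 / (σu ^ 2 * (t + δ))) = m * (q - 1) := by
    rw [hm, hq]; field_simp
  have e4 : K * (-(σl ^ 2 / (2 * σu ^ 2)) / (t + δ) + (x - z) ^ 2 / (2 * σu ^ 2 * (t + δ) ^ 2)) =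
      m * (σu ^ 2 * q - σl ^ 2) / 2 := by
    rw [hm, hq]; field_simp; ring
  rw [e3, e4]
  rcases le_total 1 q with h1 | h1
  · rw [G_eq_of_nonneg (mul_nonneg hm0 (by linarith))]
    nlinarith [mul_nonneg hm0 (sub_nonneg.2 h)]
  · rw [G_eq_of_nonpos (mul_nonpos_of_nonneg_of_nonpos hm0 (by linarith))]
    nlinarith [mul_nonneg (mul_nonneg hm0 hq0) (sub_nonneg.2 h)]

/-- The barrier is at most `k (δ / t) ^ (σl² / (2σu²))`, and the exponent is positive. -/
lemma tendsto_barrier {σl σu k z t x : ℝ} (hσl : 0 < σl) (hσu : 0 < σu) (hk : 0 ≤ k) (ht : 0 < t) :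
    Tendsto (fun δ => barrier σl σu k δ z (t, x)) (𝓝[>] 0) (𝓝 0) := by
  have h1 : Tendsto (fun δ : ℝ => k * Real.exp (σl ^ 2 / (2 * σu ^ 2) * (Real.log δ - Real.log t)))
      (𝓝[>] 0) (𝓝 (k * 0)) := by
    refine Tendsto.const_mul k (Real.tendsto_exp_atBot.comp ?_)
    refine Tendsto.const_mul_atBot (by positivity) ?_
    exact tendsto_atBot_add_const_right _ _ Real.tendsto_log_nhdsGT_zero
  rw [mul_zero] at h1
  refine squeeze_zero' (Eventually.of_forall fun δ => barrier_nonneg hk _) ?_ h1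
  filter_upwards [self_mem_nhdsWithin] with δ hδ
  have hδ : 0 < δ := hδ
  have h2 : Real.log t ≤ Real.log (t + δ) := Real.log_le_log ht (by linarith)
  have h3 : 0 ≤ (x - z) ^ 2 / (2 * σu ^ 2 * (t + δ)) := by positivity
  have h4 : σl ^ 2 / (2 * σu ^ 2) * (Real.log δ - Real.log (t + δ)) ≤
    σl ^ 2 / (2 * σu ^ 2) * (Real.log δ - Real.log t) := by gcongr
  unfold barrier
  gcongr
  simp only
  linarith

/-- Comparison principle in which the initial ordering may fail at two points. -/
theorem le_of_isSubsolutionOf_of_ne {σl σu : ℝ} (hσl : 0 < σl) (hσ : σl ≤ σu) {F : ℝ → ℝ}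
    (hF : ∀ a b, F (a + b) ≤ F a + G σl σu b) {w : ℝ → ℝ → ℝ} {M : ℝ} (hM0 : 0 < M)
    (hcont : ContinuousOn (fun p : ℝ × ℝ => w p.1 p.2) (Ioi 0 ×ˢ univ))
    (hsub : IsSubsolutionOf F w) {P : ℝ × ℝ → ℝ}
    (hP : ∀ p : ℝ × ℝ, 0 < p.1 → IsSuperAt F P p)
    (hM : ∀ t x : ℝ, 0 < t → w t x - P (t, x) ≤ M) {z₁ z₂ : ℝ}
    (hinit : ∀ x ε : ℝ, x ≠ z₁ → x ≠ z₂ → 0 < ε →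
      ∀ᶠ p in 𝓝[Ioi 0 ×ˢ univ] ((0 : ℝ), x), w p.1 p.2 ≤ P p + ε)
    {t₀ x₀ : ℝ} (ht₀ : 0 < t₀) : w t₀ x₀ ≤ P (t₀, x₀) := by
  have hσu : 0 < σu := hσl.trans_le hσ
  have hk : 0 ≤ 2 * M := by linarith
  let b (δ z : ℝ) := barrier σl σu (2 * M) δ z
  have hb0 : ∀ δ z p, 0 ≤ b δ z p := fun _ _ _ => barrier_nonneg hk _
  -- The height `2M` at `(0, z)` leaves room, by continuity, for a value of at least `M` nearby,
  -- which beats `w - P`.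
  have hnear : ∀ δ > 0, ∀ z, ∀ᶠ p in 𝓝[Ioi 0 ×ˢ univ] ((0 : ℝ), z), M ≤ b δ z p := by
    intro δ hδ z
    have hc : ContinuousAt (b δ z) (0, z) :=
      (contDiffAt_barrier (p := (0, z)) hσu (by simpa using hδ)).continuousAt
    have h1 : M < b δ z (0, z) := by simp [b, barrier]; linarith
    exact ((hc.eventually (lt_mem_nhds h1)).mono fun p hp => hp.le).filter_mono nhdsWithin_le_nhds
  have key : ∀ δ > 0, w t₀ x₀ ≤ P (t₀, x₀) + b δ z₁ (t₀, x₀) + b δ z₂ (t₀, x₀) := by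
    intro δ hδ
    refine le_of_isSubsolutionOf (P := fun p => P p + b δ z₁ p + b δ z₂ p) (M := M) hF hcont hsub
      (fun p hp => ((hP p hp).add hF (barrier_isSuperAt hσl hσ hk hδ hp)).add hF
        (barrier_isSuperAt hσl hσ hk hδ hp)) (fun t x ht => ?_) (fun x ε hε => ?_) ht₀
    · linarith [hM t x ht, hb0 δ z₁ (t, x), hb0 δ z₂ (t, x)]
    · rcases eq_or_ne x z₁ with rfl | h1
      · filter_upwards [hnear δ hδ x, self_mem_nhdsWithin] with p hp hp0
        linarith [hM p.1 p.2 hp0.1, hb0 δ z₂ p]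
      rcases eq_or_ne x z₂ with rfl | h2
      · filter_upwards [hnear δ hδ x, self_mem_nhdsWithin] with p hp hp0
        linarith [hM p.1 p.2 hp0.1, hb0 δ z₁ p]
      filter_upwards [hinit x ε h1 h2 hε] with p hp
      linarith [hb0 δ z₁ p, hb0 δ z₂ p]
  have hlim : Tendsto (fun δ => P (t₀, x₀) + b δ z₁ (t₀, x₀) + b δ z₂ (t₀, x₀)) (𝓝[>] 0)
      (𝓝 (P (t₀, x₀) + 0 + 0)) :=
    (tendsto_const_nhds.add (tendsto_barrier hσl hσu hk ht₀)).add
      (tendsto_barrier hσl hσu hk ht₀)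
  simp only [add_zero] at hlim
  exact ge_of_tendsto hlim (eventually_mem_nhdsWithin.mono fun δ hδ => key δ hδ)

/-! ### The Gaussian kernel and the profile -/

lemma stdPDF_eq (z : ℝ) : stdPDF z = (√(2 * Real.pi))⁻¹ * Real.exp (-(z ^ 2 / 2)) := by
  simp [stdPDF, ProbabilityTheory.gaussianPDFReal, neg_div]

lemma stdPDF_pos (z : ℝ) : 0 < stdPDF z := by
  rw [stdPDF_eq]; positivity

lemma stdPDF_neg (z : ℝ) : stdPDF (-z) = stdPDF z := by simp [stdPDF_eq]

lemma hasDerivAt_stdPDF_div {σ : ℝ} (z : ℝ) :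
    HasDerivAt (fun z => stdPDF (z / σ)) (-z / σ ^ 2 * stdPDF (z / σ)) z := by
  have h := (((((hasDerivAt_id z).div_const σ).pow 2).div_const 2).fun_neg.exp).const_mul
    (√(2 * Real.pi))⁻¹
  simp only [stdPDF_eq]
  refine h.congr_deriv ?_
  simp
  ring

/-- The integrand of `profile`. -/
noncomputable def kern (σl σu z : ℝ) : ℝ := if 0 ≤ z then stdPDF (z / σu) else stdPDF (z / σl)

lemma kern_of_nonneg {σl σu z : ℝ} (hz : 0 ≤ z) : kern σl σu z = stdPDF (z / σu) := if_pos hz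

lemma kern_of_nonpos {σl σu z : ℝ} (hz : z ≤ 0) : kern σl σu z = stdPDF (z / σl) := by
  rcases hz.eq_or_lt with rfl | hz
  · simp [kern]
  · exact if_neg hz.not_ge

lemma kern_pos (σl σu z : ℝ) : 0 < kern σl σu z := by
  unfold kern; split_ifs <;> exact stdPDF_pos _

/-- The derivative of `profile`. -/
noncomputable def profileDeriv (σl σu y : ℝ) : ℝ := 2 / (σu + σl) * kern σl σu (-y)

/-- The second derivative of `profile`. -/
noncomputable def profileDeriv₂ (σl σu y : ℝ) : ℝ :=
  (if y ≤ 0 then -y / σu ^ 2 else -y / σl ^ 2) * profileDeriv σl σu y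

lemma profileDeriv_of_nonpos {σl σu y : ℝ} (hy : y ≤ 0) :
    profileDeriv σl σu y = 2 / (σu + σl) * stdPDF (y / σu) := by
  rw [profileDeriv, kern_of_nonneg (by linarith), neg_div, stdPDF_neg]

lemma profileDeriv_of_nonneg {σl σu y : ℝ} (hy : 0 ≤ y) :
    profileDeriv σl σu y = 2 / (σu + σl) * stdPDF (y / σl) := by
  rw [profileDeriv, kern_of_nonpos (by linarith), neg_div, stdPDF_neg]

lemma profileDeriv_pos {σl σu : ℝ} (hσl : 0 < σl) (hσu : 0 < σu) (y : ℝ) :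
    0 < profileDeriv σl σu y :=
  mul_pos (by positivity) (kern_pos _ _ _)

lemma profileDeriv₂_of_nonpos {σl σu y : ℝ} (hy : y ≤ 0) :
    profileDeriv₂ σl σu y = -y / σu ^ 2 * profileDeriv σl σu y := by
  rw [profileDeriv₂, if_pos hy]

lemma profileDeriv₂_of_nonneg {σl σu y : ℝ} (hy : 0 ≤ y) :
    profileDeriv₂ σl σu y = -y / σl ^ 2 * profileDeriv σl σu y := by
  rcases hy.eq_or_lt with rfl | hy
  · simp [profileDeriv₂]
  · rw [profileDeriv₂, if_neg hy.not_ge]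

/-- The two Gaussian branches agree at `0` in value, and both have slope `0` there, so switching
variances does not spoil `C²` regularity. -/
lemma hasDerivAt_profileDeriv {σl σu : ℝ} (y : ℝ) :
    HasDerivAt (profileDeriv σl σu) (profileDeriv₂ σl σu y) y := by
  have hr : 0 ≤ y → HasDerivWithinAt (profileDeriv σl σu) (profileDeriv₂ σl σu y) (Ici 0) y := by
    intro hy
    have h := ((hasDerivAt_stdPDF_div (σ := σl) y).const_mul (2 / (σu + σl))).hasDerivWithinAt
      (s := Ici 0)
    refine (h.congr (fun z hz => profileDeriv_of_nonneg hz) (profileDeriv_of_nonneg hy)).congr_deriv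
      ?_
    rw [profileDeriv₂_of_nonneg hy, profileDeriv_of_nonneg hy]; ring
  have hl : y ≤ 0 → HasDerivWithinAt (profileDeriv σl σu) (profileDeriv₂ σl σu y) (Iic 0) y := by
    intro hy
    have h := ((hasDerivAt_stdPDF_div (σ := σu) y).const_mul (2 / (σu + σl))).hasDerivWithinAt
      (s := Iic 0)
    refine (h.congr (fun z hz => profileDeriv_of_nonpos hz) (profileDeriv_of_nonpos hy)).congr_deriv
      ?_
    rw [profileDeriv₂_of_nonpos hy, profileDeriv_of_nonpos hy]; ring
  rcases lt_trichotomy y 0 with hy | rfl | hy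
  · exact (hl hy.le).hasDerivAt (Iic_mem_nhds hy)
  · have := (hl le_rfl).union (hr le_rfl)
    rwa [Iic_union_Ici, hasDerivWithinAt_univ] at this
  · exact (hr hy.le).hasDerivAt (Ici_mem_nhds hy)

lemma continuous_profileDeriv {σl σu : ℝ} : Continuous (profileDeriv σl σu) :=
  continuous_iff_continuousAt.2 fun y => (hasDerivAt_profileDeriv y).continuousAt

lemma continuous_profileDeriv₂ {σl σu : ℝ} : Continuous (profileDeriv₂ σl σu) := by
  refine Continuous.mul ?_ continuous_profileDeriv
  refine Continuous.if_le (by fun_prop) (by fun_prop) continuous_id continuous_const ?_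
  rintro y rfl
  simp

lemma continuous_kern {σl σu : ℝ} : Continuous (kern σl σu) := by
  have h (σ : ℝ) : Continuous fun z => stdPDF (z / σ) :=
    continuous_iff_continuousAt.2 fun z => (hasDerivAt_stdPDF_div z).continuousAt
  refine Continuous.if_le (h _) (h _) continuous_const continuous_id ?_
  rintro y rfl
  simp

lemma integrable_stdPDF_div {σ : ℝ} (hσ : 0 < σ) : Integrable (fun z => stdPDF (z / σ)) := by
  have := (ProbabilityTheory.integrable_gaussianPDFReal 0 1).comp_div hσ.ne'
  exact this

lemma integral_Ioi_stdPDF_div {σ : ℝ} (hσ : 0 < σ) : ∫ z in Ioi 0, stdPDF (z / σ) = σ / 2 := by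
  have h := integral_gaussian_Ioi (1 / (2 * σ ^ 2))
  have e : ∀ z : ℝ, stdPDF (z / σ) =
      (√(2 * Real.pi))⁻¹ * Real.exp (-(1 / (2 * σ ^ 2)) * z ^ 2) := fun z => by
    rw [stdPDF_eq]; congr 2; field_simp
  simp_rw [e]
  rw [integral_const_mul, h,
    show Real.pi / (1 / (2 * σ ^ 2)) = 2 * Real.pi * σ ^ 2 by field_simp,
    Real.sqrt_mul (by positivity) (σ ^ 2), Real.sqrt_sq hσ.le]
  have : √(2 * Real.pi) ≠ 0 := by positivity
  field_simp

lemma integral_Iic_stdPDF_div {σ : ℝ} (hσ : 0 < σ) : ∫ z in Iic 0, stdPDF (z / σ) = σ / 2 := by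
  rw [← integral_Ioi_stdPDF_div hσ, ← neg_zero, ← integral_comp_neg_Ioi]
  simp [neg_div, stdPDF_neg]

lemma integral_Ioi_kern {σl σu : ℝ} (hσu : 0 < σu) : ∫ z in Ioi 0, kern σl σu z = σu / 2 := by
  rw [← integral_Ioi_stdPDF_div hσu]
  exact setIntegral_congr_fun measurableSet_Ioi fun z hz => kern_of_nonneg (le_of_lt hz)

lemma integral_Iic_kern {σl σu : ℝ} (hσl : 0 < σl) : ∫ z in Iic 0, kern σl σu z = σl / 2 := by
  rw [← integral_Iic_stdPDF_div hσl]
  exact setIntegral_congr_fun measurableSet_Iic fun z hz => kern_of_nonpos hz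

lemma integrable_kern {σl σu : ℝ} (hσl : 0 < σl) (hσu : 0 < σu) : Integrable (kern σl σu) := by
  rw [← integrableOn_univ, ← Iic_union_Ioi (a := (0 : ℝ)), integrableOn_union]
  exact ⟨(integrable_stdPDF_div hσl).integrableOn.congr_fun
      (fun z hz => (kern_of_nonpos hz).symm) measurableSet_Iic,
    (integrable_stdPDF_div hσu).integrableOn.congr_fun
      (fun z hz => (kern_of_nonneg (le_of_lt hz)).symm) measurableSet_Ioi⟩

lemma profile_eq {σl σu : ℝ} (hσl : 0 < σl) (hσu : 0 < σu) (y : ℝ) :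
    profile σl σu y = 2 / (σu + σl) * (σu / 2 - ∫ z in (0 : ℝ)..(-y), kern σl σu z) := by
  have hi := integrable_kern hσl hσu
  have h := intervalIntegral.integral_interval_add_Ioi (a := 0) (b := -y) (f := kern σl σu)
    (μ := volume) hi.integrableOn hi.integrableOn
  rw [integral_Ioi_kern hσu] at h
  rw [← h]
  simp [profile, kern]

lemma hasDerivAt_profile {σl σu : ℝ} (hσl : 0 < σl) (hσu : 0 < σu) (y : ℝ) :
    HasDerivAt (profile σl σu) (profileDeriv σl σu y) y := by
  have h1 : HasDerivAt (fun a => ∫ z in (0 : ℝ)..a, kern σl σu z) (kern σl σu (-y)) (-y) :=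
    continuous_kern.integral_hasStrictDerivAt 0 (-y) |>.hasDerivAt
  have h2 := ((h1.comp y (hasDerivAt_neg y)).const_sub (σu / 2)).const_mul (2 / (σu + σl))
  refine (h2.congr_deriv ?_).congr_of_eventuallyEq (Eventually.of_forall fun z => ?_)
  · simp [profileDeriv]
  · exact profile_eq hσl hσu z

lemma contDiff_profile {σl σu : ℝ} (hσl : 0 < σl) (hσu : 0 < σu) :
    ContDiff ℝ 2 (profile σl σu) := by
  have e1 : deriv (profile σl σu) = profileDeriv σl σu :=
    funext fun y => (hasDerivAt_profile hσl hσu y).deriv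
  have e2 : deriv (profileDeriv σl σu) = profileDeriv₂ σl σu :=
    funext fun y => (hasDerivAt_profileDeriv y).deriv
  rw [show (2 : WithTop ℕ∞) = 1 + 1 by norm_num, contDiff_succ_iff_deriv]
  refine ⟨fun y => (hasDerivAt_profile hσl hσu y).differentiableAt, by simp, ?_⟩
  rw [e1, contDiff_one_iff_deriv, e2]
  exact ⟨fun y => (hasDerivAt_profileDeriv y).differentiableAt, continuous_profileDeriv₂⟩

/-- The kernel has masses `σl / 2` and `σu / 2` on the two half-lines; the prefactor normalises
their sum. -/
lemma tendsto_profile_atTop {σl σu : ℝ} (hσl : 0 < σl) (hσu : 0 < σu) :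
    Tendsto (profile σl σu) atTop (𝓝 1) := by
  have h := intervalIntegral_tendsto_integral_Iic (f := kern σl σu) 0
    (integrable_kern hσl hσu).integrableOn tendsto_neg_atTop_atBot
  rw [integral_Iic_kern hσl] at h
  have h2 := (h.const_add (σu / 2)).const_mul (2 / (σu + σl))
  have e : 2 / (σu + σl) * (σu / 2 + σl / 2) = 1 := by field_simp
  rw [e] at h2
  refine h2.congr fun y => ?_
  rw [profile_eq hσl hσu, intervalIntegral.integral_symm]; ring

lemma tendsto_profile_atBot {σl σu : ℝ} (hσl : 0 < σl) (hσu : 0 < σu) :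
    Tendsto (profile σl σu) atBot (𝓝 0) := by
  have h := intervalIntegral_tendsto_integral_Ioi (f := kern σl σu) 0
    (integrable_kern hσl hσu).integrableOn tendsto_neg_atBot_atTop
  rw [integral_Ioi_kern hσu] at h
  have h2 := (h.const_sub (σu / 2)).const_mul (2 / (σu + σl))
  rw [sub_self, mul_zero] at h2
  exact h2.congr fun y => (profile_eq hσl hσu y).symm

lemma profile_zero {σl σu : ℝ} (hσl : 0 < σl) (hσu : 0 < σu) :
    profile σl σu 0 = σu / (σu + σl) := by
  rw [profile_eq hσl hσu]; simp

lemma strictMono_profile {σl σu : ℝ} (hσl : 0 < σl) (hσu : 0 < σu) :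
    StrictMono (profile σl σu) :=
  strictMono_of_hasDerivAt_pos (hasDerivAt_profile hσl hσu) (profileDeriv_pos hσl hσu)

lemma profile_pos {σl σu : ℝ} (hσl : 0 < σl) (hσu : 0 < σu) (y : ℝ) : 0 < profile σl σu y :=
  ((strictMono_profile hσl hσu).monotone.le_of_tendsto (tendsto_profile_atBot hσl hσu)
    (y - 1)).trans_lt (strictMono_profile hσl hσu (by linarith))

lemma profile_le_one {σl σu : ℝ} (hσl : 0 < σl) (hσu : 0 < σu) (y : ℝ) : profile σl σu y ≤ 1 :=
  (strictMono_profile hσl hσu).monotone.ge_of_tendsto (tendsto_profile_atTop hσl hσu) y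

lemma convexOn_profile {σl σu : ℝ} (hσl : 0 < σl) (hσu : 0 < σu) :
    ConvexOn ℝ (Iic 0) (profile σl σu) := by
  have e1 : deriv (profile σl σu) = profileDeriv σl σu :=
    funext fun y => (hasDerivAt_profile hσl hσu y).deriv
  have hc := (contDiff_profile hσl hσu)
  refine MonotoneOn.convexOn_of_deriv (convex_Iic 0) hc.continuous.continuousOn
    (hc.differentiable (by norm_num)).differentiableOn ?_
  rw [e1, interior_Iic]
  refine monotoneOn_of_deriv_nonneg (convex_Iio 0) continuous_profileDeriv.continuousOn
    (fun y _ => (hasDerivAt_profileDeriv y).differentiableAt.differentiableWithinAt) fun y hy => ?_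
  rw [interior_Iio] at hy
  rw [(hasDerivAt_profileDeriv y).deriv, profileDeriv₂_of_nonpos hy.le]
  have h1 := profileDeriv_pos hσl hσu y
  have h2 : 0 ≤ -y := by linarith [mem_Iio.1 hy]
  positivity

/-- A Mills ratio bound: the lower tail of `profile` dominates
`2 σu / (σu + σl) · φ(p) p / (1 + p²)` with `p = y / σu`. -/
lemma le_profile_neg {σl σu y : ℝ} (hσl : 0 < σl) (hσu : 0 < σu) (hy : 0 ≤ y) :
    2 * σu / (σu + σl) * (stdPDF (y / σu) * (y / σu / (1 + (y / σu) ^ 2))) ≤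
      profile σl σu (-y) := by
  set H : ℝ → ℝ := fun y => profile σl σu (-y) -
    2 * σu / (σu + σl) * (stdPDF (y / σu) * (y / σu / (1 + (y / σu) ^ 2))) with hH
  -- The derivative of the difference collapses to a single negative term; as the difference
  -- decreases to `0` at infinity, it is nonnegative.
  have hd : ∀ z, 0 ≤ z → HasDerivAt H
      (-(4 / (σu + σl) * (stdPDF (z / σu) / (1 + (z / σu) ^ 2) ^ 2))) z := by
    intro z hz
    have h1 := (hasDerivAt_profile hσl hσu (-z)).comp z (hasDerivAt_neg z)
    have h0 : HasDerivAt (fun z => z / σu) (1 / σu) z := (hasDerivAt_id z).div_const σu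
    have hne : 1 + (z / σu) ^ 2 ≠ 0 := by positivity
    have h2 := h0.fun_div ((h0.fun_pow 2).const_add 1) hne
    have h3 := h1.sub (((hasDerivAt_stdPDF_div (σ := σu) z).mul h2).const_mul (2 * σu / (σu + σl)))
    refine h3.congr_deriv ?_
    rw [profileDeriv_of_nonpos (by linarith), neg_div, stdPDF_neg]
    generalize stdPDF (z / σu) = q
    simp only [Nat.cast_ofNat, Nat.add_one_sub_one, pow_one]
    field_simp
    ring
  have hanti : AntitoneOn H (Ici 0) := by
    refine antitoneOn_of_deriv_nonpos (convex_Ici 0)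
      (fun z hz => (hd z hz).continuousAt.continuousWithinAt)
      (fun z hz => (hd z (interior_subset hz)).differentiableAt.differentiableWithinAt)
      fun z hz => ?_
    rw [(hd z (interior_subset hz)).deriv]
    have := stdPDF_pos (z / σu)
    rw [neg_nonpos]; positivity
  have hlim : Tendsto H atTop (𝓝 0) := by
    have h1 := (tendsto_profile_atBot hσl hσu).comp tendsto_neg_atTop_atBot
    have h2 : Tendsto (fun y : ℝ => stdPDF (y / σu)) atTop (𝓝 0) := by
      have h3 : Tendsto (fun y : ℝ => (y / σu) ^ 2 / 2) atTop atTop :=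
        ((tendsto_pow_atTop two_ne_zero).comp (tendsto_id.atTop_div_const hσu)).atTop_div_const
          two_pos
      have h4 := (Real.tendsto_exp_neg_atTop_nhds_zero.comp h3).const_mul (√(2 * Real.pi))⁻¹
      rw [mul_zero] at h4
      exact h4.congr fun y => (stdPDF_eq _).symm
    have h5 : Tendsto (fun y : ℝ => stdPDF (y / σu) * (y / σu / (1 + (y / σu) ^ 2)))
        atTop (𝓝 0) := by
      refine squeeze_zero' ?_ ?_ h2
      · filter_upwards [eventually_ge_atTop 0] with z hz
        have := stdPDF_pos (z / σu)
        positivity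
      · refine Eventually.of_forall fun z => mul_le_of_le_one_right (stdPDF_pos _).le ?_
        rw [div_le_one (by positivity)]
        nlinarith [sq_nonneg (z / σu - 1), sq_nonneg (z / σu)]
    have := h1.sub (h5.const_mul (2 * σu / (σu + σl)))
    rw [mul_zero, sub_zero] at this
    exact this
  have h0 : 0 ≤ H y := by
    refine le_of_tendsto hlim ?_
    filter_upwards [eventually_ge_atTop y] with z hz
    exact hanti hy (hy.trans hz) hz
  simp only [hH] at h0
  linarith

/-! ### Self-similar waves -/

/-- The self-similar solution `f((e x - c) / √t)` of the G-heat equation, where `e = ±1`. -/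
noncomputable def wave (σl σu c e : ℝ) (p : ℝ × ℝ) : ℝ :=
  profile σl σu ((e * p.2 - c) / √p.1)

section Wave

variable {σl σu c e : ℝ}

lemma contDiffAt_wave (hσl : 0 < σl) (hσu : 0 < σu) {p : ℝ × ℝ} (hp : 0 < p.1) :
    ContDiffAt ℝ 2 (wave σl σu c e) p := by
  refine (contDiff_profile hσl hσu).contDiffAt.comp p ?_
  exact ContDiffAt.div (by fun_prop) (ContDiffAt.sqrt (by fun_prop) hp.ne') (by positivity)

lemma iteratedDeriv_wave (hσl : 0 < σl) (hσu : 0 < σu) (he : e ^ 2 = 1) {t x : ℝ} (ht : 0 < t) :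
    iteratedDeriv 2 (fun y => wave σl σu c e (t, y)) x =
      profileDeriv₂ σl σu ((e * x - c) / √t) / t := by
  have h0 : ∀ y, HasDerivAt (fun y => (e * y - c) / √t) (e / √t) y := fun y => by
    simpa using (((hasDerivAt_id y).const_mul e).sub_const c).div_const √t
  refine iteratedDeriv_two_eq
    (Eventually.of_forall fun y => (hasDerivAt_profile hσl hσu _).comp y (h0 y)) ?_
  refine (((hasDerivAt_profileDeriv _).comp x (h0 x)).mul_const (e / √t)).congr_deriv ?_
  rw [mul_assoc, ← sq, div_pow, he, Real.sq_sqrt ht.le, mul_one_div]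

lemma deriv_wave (hσl : 0 < σl) (hσu : 0 < σu) {t x : ℝ} (ht : 0 < t) :
    deriv (fun s => wave σl σu c e (s, x)) t =
      -((e * x - c) / √t) / (2 * t) * profileDeriv σl σu ((e * x - c) / √t) := by
  have hq : 0 < √t := Real.sqrt_pos.2 ht
  have h0 := (hasDerivAt_const t (e * x - c)).div (Real.hasDerivAt_sqrt ht.ne') hq.ne'
  have h1 := (hasDerivAt_profile hσl hσu ((e * x - c) / √t)).comp t h0
  refine (h1.congr_deriv ?_).deriv
  rw [mul_comm]
  congr 1
  have : t = √t ^ 2 := (Real.sq_sqrt ht.le).symm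
  generalize √t = q at *
  subst this
  field_simp
  ring

/-- On each side of `0` the variance chosen by `G` cancels the one in the denominator of
`profileDeriv₂`, leaving one formula that matches the time derivative of the wave. -/
lemma G_profileDeriv₂ (hσl : 0 < σl) (hσu : 0 < σu) {t : ℝ} (ht : 0 < t) (y : ℝ) :
    G σl σu (profileDeriv₂ σl σu y / t) = -y / (2 * t) * profileDeriv σl σu y := by
  have h := profileDeriv_pos hσl hσu y
  rcases le_total y 0 with hy | hy
  · have h0 : 0 ≤ -y := by linarith
    rw [profileDeriv₂_of_nonpos hy, G_eq_of_nonneg (by positivity)]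
    field_simp
  · rw [profileDeriv₂_of_nonneg hy, G_eq_of_nonpos]
    · field_simp
    · rw [neg_div, neg_mul, neg_div, neg_nonpos]; positivity

lemma deriv_wave_eq_G (hσl : 0 < σl) (hσu : 0 < σu) (he : e ^ 2 = 1) {t x : ℝ} (ht : 0 < t) :
    deriv (fun s => wave σl σu c e (s, x)) t =
      G σl σu (iteratedDeriv 2 (fun y => wave σl σu c e (t, y)) x) := by
  rw [iteratedDeriv_wave hσl hσu he ht, G_profileDeriv₂ hσl hσu ht, deriv_wave hσl hσu ht]

lemma wave_isSuperAt (hσl : 0 < σl) (hσu : 0 < σu) (he : e ^ 2 = 1) {p : ℝ × ℝ} (hp : 0 < p.1) :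
    IsSuperAt (G σl σu) (wave σl σu c e) p :=
  ⟨contDiffAt_wave hσl hσu hp, (deriv_wave_eq_G hσl hσu he hp).ge⟩

lemma iteratedDeriv_wave_nonneg (hσl : 0 < σl) (hσu : 0 < σu) (he : e ^ 2 = 1) {t x : ℝ}
    (ht : 0 < t) (hx : e * x ≤ c) : 0 ≤ iteratedDeriv 2 (fun y => wave σl σu c e (t, y)) x := by
  rw [iteratedDeriv_wave hσl hσu he ht]
  have hy : (e * x - c) / √t ≤ 0 := div_nonpos_of_nonpos_of_nonneg (by linarith) (by positivity)
  have h := profileDeriv_pos hσl hσu ((e * x - c) / √t)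
  have h0 := neg_nonneg.2 hy
  rw [profileDeriv₂_of_nonpos hy]
  positivity

lemma tendsto_inv_sqrt_fst (x : ℝ) :
    Tendsto (fun p : ℝ × ℝ => (√p.1)⁻¹) (𝓝[Ioi 0 ×ˢ univ] ((0 : ℝ), x)) atTop := by
  refine tendsto_inv_nhdsGT_zero.comp (tendsto_nhdsWithin_iff.2 ⟨?_, ?_⟩)
  · have : ContinuousAt (fun p : ℝ × ℝ => √p.1) (0, x) := by fun_prop
    have h := this.tendsto
    simp only [Real.sqrt_zero] at h
    exact h.mono_left nhdsWithin_le_nhds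
  · filter_upwards [self_mem_nhdsWithin] with p hp
    exact Real.sqrt_pos.2 hp.1

lemma tendsto_wave_one (hσl : 0 < σl) (hσu : 0 < σu) {x : ℝ} (hx : c < e * x) :
    Tendsto (wave σl σu c e) (𝓝[Ioi 0 ×ˢ univ] ((0 : ℝ), x)) (𝓝 1) := by
  refine (tendsto_profile_atTop hσl hσu).comp ?_
  have h : ContinuousAt (fun p : ℝ × ℝ => e * p.2 - c) (0, x) := by fun_prop
  exact (h.tendsto.mono_left nhdsWithin_le_nhds).pos_mul_atTop (sub_pos.2 hx)
    (tendsto_inv_sqrt_fst x)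

lemma tendsto_wave_zero (hσl : 0 < σl) (hσu : 0 < σu) {x : ℝ} (hx : e * x < c) :
    Tendsto (wave σl σu c e) (𝓝[Ioi 0 ×ˢ univ] ((0 : ℝ), x)) (𝓝 0) := by
  refine (tendsto_profile_atBot hσl hσu).comp ?_
  have h : ContinuousAt (fun p : ℝ × ℝ => e * p.2 - c) (0, x) := by fun_prop
  exact (h.tendsto.mono_left nhdsWithin_le_nhds).neg_mul_atTop (sub_neg.2 hx)
    (tendsto_inv_sqrt_fst x)

end Wave

/-! ### The absolute error -/

/-- The absolute error bound, as a function of time. -/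
noncomputable def errBound (σl σu c t : ℝ) : ℝ :=
  (σu - σl) * √t / (c * √(2 * Real.pi)) * Real.exp (-(2 * c ^ 2 / (σu ^ 2 * t)))

section ErrBound

variable {σl σu c : ℝ}

lemma errBound_nonneg (hσ : σl ≤ σu) (hc : 0 < c) (t : ℝ) : 0 ≤ errBound σl σu c t := by
  have := sub_nonneg.2 hσ
  unfold errBound; positivity

lemma errBound_eq (hσu : 0 < σu) {t : ℝ} (ht : 0 < t) :
    errBound σl σu c t = (σu - σl) * √t / c * stdPDF (2 * (c / √t / σu)) := by
  have h : (2 * (c / √t / σu)) ^ 2 / 2 = 2 * c ^ 2 / (σu ^ 2 * t) := by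
    rw [mul_pow, div_pow, div_pow, Real.sq_sqrt ht.le]; field_simp
  rw [errBound, stdPDF_eq, h]
  have : √(2 * Real.pi) ≠ 0 := by positivity
  field_simp

/-- Written in terms of `r = 2c / (σu √t)` so that the factor `φ(r) (r + 1/r)` matches
`mul_stdPDF_le`. -/
lemma hasDerivAt_errBound (hσu : 0 < σu) (hc : 0 < c) {t : ℝ} (ht : 0 < t) :
    HasDerivAt (errBound σl σu c) ((σu - σl) / (σu * t) * (stdPDF (2 * (c / √t / σu)) *
      (2 * (c / √t / σu) + 1 / (2 * (c / √t / σu))))) t := by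
  have h : (2 * (c / √t / σu)) ^ 2 / 2 = 2 * c ^ 2 / (σu ^ 2 * t) := by
    rw [mul_pow, div_pow, div_pow, Real.sq_sqrt ht.le]; field_simp
  have hq : 0 < √t := Real.sqrt_pos.2 ht
  have h1 := (((Real.hasDerivAt_sqrt ht.ne').const_mul (σu - σl)).div_const
    (c * √(2 * Real.pi))).mul (((hasDerivAt_const t (2 * c ^ 2)).fun_div
      ((hasDerivAt_id t).const_mul (σu ^ 2)) (by simp only [id]; positivity)).fun_neg.exp)
  refine h1.congr_deriv ?_
  rw [stdPDF_eq, h]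
  simp only [id]
  have h2 : √(2 * Real.pi) ≠ 0 := by positivity
  generalize Real.exp (-(2 * c ^ 2 / (σu ^ 2 * t))) = E
  generalize √(2 * Real.pi) = ρ at *
  have : t = √t ^ 2 := (Real.sq_sqrt ht.le).symm
  generalize √t = q at *
  subst this
  field_simp
  ring

/-- The ratio `φ(r) / φ(m) = exp ((m² - r²) / 2)` is at least `1 + r (m - r)`, and multiplying by `r
+ 1/r` already exceeds `m`. As `m φ(m)` increases for `m < 1`, the bound `r φ(r)` alone would fail
for small `r`. -/
lemma mul_stdPDF_le {r m : ℝ} (hr : 0 < r) (hm : r ≤ m) :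
    m * stdPDF m ≤ stdPDF r * (r + 1 / r) := by
  have h1 : m ≤ Real.exp ((m ^ 2 - r ^ 2) / 2) * (r + 1 / r) := by
    have h2 := Real.add_one_le_exp ((m ^ 2 - r ^ 2) / 2)
    refine le_trans ?_ (mul_le_mul_of_nonneg_right h2 (by positivity))
    have h3 : r * (m - r) + 1 ≤ (m ^ 2 - r ^ 2) / 2 + 1 := by nlinarith [sq_nonneg (m - r)]
    refine le_trans ?_ (mul_le_mul_of_nonneg_right h3 (by positivity))
    have e : (r * (m - r) + 1) * (r + 1 / r) = m + r ^ 2 * (m - r) + 1 / r := by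
      field_simp; ring
    have : 0 ≤ r ^ 2 * (m - r) := mul_nonneg (sq_nonneg r) (by linarith)
    rw [e]
    have : 0 < 1 / r := by positivity
    linarith
  have h4 : stdPDF m * Real.exp ((m ^ 2 - r ^ 2) / 2) = stdPDF r := by
    rw [stdPDF_eq, stdPDF_eq, mul_assoc, ← Real.exp_add]; congr 2; ring
  calc m * stdPDF m = stdPDF m * m := mul_comm _ _
    _ ≤ stdPDF m * (Real.exp ((m ^ 2 - r ^ 2) / 2) * (r + 1 / r)) :=
        mul_le_mul_of_nonneg_left h1 (stdPDF_pos m).le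
    _ = stdPDF r * (r + 1 / r) := by rw [← mul_assoc, h4]

/-- `G` has slope at least `σl² / 2` everywhere, so `G (a + b) - G a ≥ σl² b / 2`, whereas `G b =
σu² b / 2`. -/
lemma G_add_G_sub_le (hσl : 0 < σl) (hσ : σl ≤ σu) {a b : ℝ} (hb : 0 ≤ b) :
    G σl σu a + G σl σu b - G σl σu (a + b) ≤ (σu ^ 2 - σl ^ 2) / 2 * b := by
  have h : σl ^ 2 ≤ σu ^ 2 := by gcongr
  rcases le_total 0 a with ha | ha <;> rcases le_total 0 (a + b) with hab | hab <;>
    simp only [G_eq_of_nonneg, G_eq_of_nonpos, ha, hb, hab] <;>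
    nlinarith [mul_nonneg (sub_nonneg.2 h) hb, mul_nonneg (sub_nonneg.2 h) (abs_nonneg a),
      mul_nonneg (sub_nonneg.2 h) (abs_nonneg (a + b)), le_abs_self a, neg_le_abs a,
      le_abs_self (a + b), neg_le_abs (a + b)]

/-- Beyond the opposite front the profile's argument is at most `-2c / √t`; this is the source of
`2c²` in the exponent of `errBound`. -/
lemma wave_curvature_le (hσl : 0 < σl) (hσ : σl ≤ σu) (hc : 0 < c) {e t x : ℝ} (he : e ^ 2 = 1)
    (ht : 0 < t) (hx : e * x ≤ -c) :
    (σu ^ 2 - σl ^ 2) / 2 * iteratedDeriv 2 (fun y => wave σl σu c e (t, y)) x ≤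
      deriv (errBound σl σu c) t := by
  have hσu : 0 < σu := hσl.trans_le hσ
  have hq : 0 < √t := Real.sqrt_pos.2 ht
  rw [iteratedDeriv_wave hσl hσu he ht, (hasDerivAt_errBound hσu hc ht).deriv]
  set y := (e * x - c) / √t with hy
  have hyr : 2 * (c / √t / σu) ≤ -y / σu := by
    have : 2 * (c / √t / σu) = (2 * c / √t) / σu := by ring
    rw [this, hy, ← neg_div]
    gcongr
    linarith
  have hr : 0 < 2 * (c / √t / σu) := by positivity
  have hy0 : y ≤ 0 := div_nonpos_of_nonpos_of_nonneg (by linarith) hq.le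
  have key := mul_stdPDF_le hr hyr
  rw [profileDeriv₂_of_nonpos hy0, profileDeriv_of_nonpos hy0]
  rw [show stdPDF (y / σu) = stdPDF (-y / σu) by rw [neg_div, stdPDF_neg]]
  have e1 : (σu ^ 2 - σl ^ 2) / 2 * (-y / σu ^ 2 * (2 / (σu + σl) * stdPDF (-y / σu)) / t) =
      (σu - σl) / (σu * t) * (-y / σu * stdPDF (-y / σu)) := by
    field_simp; ring
  rw [e1]
  have := sub_nonneg.2 hσ
  gcongr

lemma deriv_errBound_nonneg (hσl : 0 < σl) (hσ : σl ≤ σu) (hc : 0 < c) {t : ℝ} (ht : 0 < t) :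
    0 ≤ deriv (errBound σl σu c) t := by
  have hσu : 0 < σu := hσl.trans_le hσ
  have hq : 0 < √t := Real.sqrt_pos.2 ht
  rw [(hasDerivAt_errBound hσu hc ht).deriv]
  have := sub_nonneg.2 hσ
  have := stdPDF_pos (2 * (c / √t / σu))
  positivity

lemma contDiffAt_errBound (hσu : 0 < σu) {t : ℝ} (ht : 0 < t) :
    ContDiffAt ℝ 2 (errBound σl σu c) t := by
  unfold errBound
  refine ContDiffAt.mul ((contDiffAt_const.mul (contDiffAt_id.sqrt ht.ne')).div_const _)
    (ContDiffAt.exp (ContDiffAt.neg (ContDiffAt.div (by fun_prop) (by fun_prop) (by positivity))))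

/-- `errBound - u - v` is a supersolution of the equation satisfied by `-w`, i.e.
`u + v - errBound` is a subsolution of the G-heat equation. -/
lemma errBound_sub_waves_isSuperAt (hσl : 0 < σl) (hσ : σl ≤ σu) (hc : 0 < c) {p : ℝ × ℝ}
    (hp : 0 < p.1) :
    IsSuperAt (fun a => -G σl σu (-a))
      (fun p => errBound σl σu c p.1 - (wave σl σu c 1 p + wave σl σu c (-1) p)) p := by
  obtain ⟨t, x⟩ := p
  have hσu : 0 < σu := hσl.trans_le hσ
  have ht : 0 < t := hp
  have hB : ContDiffAt ℝ 2 (fun p : ℝ × ℝ => errBound σl σu c p.1) (t, x) :=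
    ContDiffAt.comp (t, x) (contDiffAt_errBound hσu ht) contDiffAt_fst
  have h1 := contDiffAt_wave (c := c) (e := 1) hσl hσu hp
  have h2 := contDiffAt_wave (c := c) (e := -1) hσl hσu hp
  refine ⟨hB.sub (h1.add h2), ?_⟩
  have e1 := deriv_wave_eq_G (c := c) (x := x) hσl hσu (show (1 : ℝ) ^ 2 = 1 by norm_num) ht
  have e2 := deriv_wave_eq_G (c := c) (x := x) hσl hσu (show (-1 : ℝ) ^ 2 = 1 by norm_num) ht
  have e3 := iteratedDeriv_two_slice_add h1 h2
  have e4 := deriv_slice_add h1 h2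
  simp only at e3 e4 ⊢
  rw [iteratedDeriv_const_sub (by norm_num), iteratedDeriv_neg, e3]
  rw [deriv_fun_sub ((contDiffAt_errBound hσu ht).differentiableAt (by norm_num))
    ((contDiffAt_slice_fst (h1.add h2)).differentiableAt (by norm_num)), e4, e1, e2]
  set a := iteratedDeriv 2 (fun y => wave σl σu c 1 (t, y)) x with ha
  set b := iteratedDeriv 2 (fun y => wave σl σu c (-1) (t, y)) x with hb
  rw [neg_neg]
  suffices G σl σu a + G σl σu b - G σl σu (a + b) ≤ deriv (errBound σl σu c) t by linarith
  have ha0 : x ≤ c → 0 ≤ a := fun hx =>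
    iteratedDeriv_wave_nonneg hσl hσu (by norm_num) ht (by linarith)
  have hb0 : -c ≤ x → 0 ≤ b := fun hx =>
    iteratedDeriv_wave_nonneg hσl hσu (by norm_num) ht (by linarith)
  -- Outside `[-c, c]` only the far wave is known to be convex, and its curvature bounds the defect;
  -- inside, both are convex and `G` is additive.
  rcases le_total c x with hx | hx
  · exact (G_add_G_sub_le hσl hσ (hb0 (by linarith))).trans
      (wave_curvature_le hσl hσ hc (by norm_num) ht (by linarith))
  rcases le_total x (-c) with hx' | hx'
  · have := G_add_G_sub_le hσl hσ (a := b) (ha0 hx)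
    rw [add_comm b a, add_comm (G σl σu b)] at this
    exact this.trans (wave_curvature_le hσl hσ hc (by norm_num) ht (by linarith))
  · have h := deriv_errBound_nonneg hσl hσ hc ht
    have h3 := ha0 hx
    have h4 := hb0 hx'
    rw [G_eq_of_nonneg h3, G_eq_of_nonneg h4, G_eq_of_nonneg (add_nonneg h3 h4)]
    linarith

end ErrBound

/-! ### The relative error -/

/-- A positive lower bound for `u + v`. -/
lemma le_wave_add_wave {σl σu c t x : ℝ} (hσl : 0 < σl) (hσ : σl ≤ σu) (hc : 0 < c) (ht : 0 < t) :
    4 * σu / (σu + σl) *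
      (stdPDF (c / √t / σu) * (c / √t / σu / (1 + (c / √t / σu) ^ 2))) ≤
      wave σl σu c 1 (t, x) + wave σl σu c (-1) (t, x) := by
  have hσu : 0 < σu := hσl.trans_le hσ
  have hq : 0 < √t := Real.sqrt_pos.2 ht
  set p := c / √t / σu with hp
  have hp0 : 0 < p := by positivity
  have hw : ∀ e, 0 < wave σl σu c e (t, x) := fun e => profile_pos hσl hσu _
  -- Past its front a wave is at least `f(0) = σu / (σu + σl)`, which suffices because `φ(p)` and `p
  -- / (1 + p²)` are both at most `1 / 2`.
  have hout : ∀ e, c ≤ e * x → 4 * σu / (σu + σl) * (stdPDF p * (p / (1 + p ^ 2))) ≤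
      wave σl σu c e (t, x) := by
    intro e he
    have h1 : σu / (σu + σl) ≤ wave σl σu c e (t, x) := by
      rw [← profile_zero hσl hσu]
      exact (strictMono_profile hσl hσu).monotone (div_nonneg (by linarith) hq.le)
    refine le_trans ?_ h1
    have h2 : stdPDF p ≤ 1 / 2 := by
      have h3 : 2 ≤ √(2 * Real.pi) := by
        refine Real.le_sqrt_of_sq_le ?_
        nlinarith [Real.pi_gt_three]
      rw [stdPDF_eq]
      calc (√(2 * Real.pi))⁻¹ * Real.exp (-(p ^ 2 / 2)) ≤ 2⁻¹ * 1 := by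
            gcongr
            exact Real.exp_le_one_iff.2 (neg_nonpos.2 (by positivity))
        _ = 1 / 2 := by norm_num
    have h4 : p / (1 + p ^ 2) ≤ 1 / 2 := by
      rw [div_le_iff₀ (by positivity)]
      nlinarith [sq_nonneg (p - 1)]
    have h5 : stdPDF p * (p / (1 + p ^ 2)) ≤ 1 / 2 * (1 / 2) := by gcongr
    calc 4 * σu / (σu + σl) * (stdPDF p * (p / (1 + p ^ 2)))
        ≤ 4 * σu / (σu + σl) * (1 / 2 * (1 / 2)) := by gcongr
      _ = σu / (σu + σl) := by ring
  by_cases h1 : c ≤ x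
  · linarith [hout 1 (by linarith), hw (-1)]
  by_cases h2 : x ≤ -c
  · linarith [hout (-1) (by linarith), hw 1]
  push Not at h1 h2
  have hy : ∀ e, e * x < c → (e * x - c) / √t ∈ Iic 0 := fun e he =>
    div_nonpos_of_nonpos_of_nonneg (by linarith) hq.le
  -- Between the fronts the two arguments are nonpositive with midpoint `-c / √t`, so the sum is at
  -- least `2 f(-c / √t)`.
  have hcv := (convexOn_profile hσl hσu).2 (hy 1 (by linarith)) (hy (-1) (by linarith))
    (show (0 : ℝ) ≤ 1 / 2 by norm_num) (show (0 : ℝ) ≤ 1 / 2 by norm_num) (by norm_num)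
  have e1 : (1 / 2 : ℝ) • ((1 * x - c) / √t) + (1 / 2 : ℝ) • ((-1 * x - c) / √t) = -(c / √t) := by
    simp only [smul_eq_mul]; ring
  rw [e1] at hcv
  have hm := le_profile_neg (y := c / √t) hσl hσu (by positivity)
  simp only [smul_eq_mul, ← hp] at hcv hm
  have e2 : 4 * σu / (σu + σl) * (stdPDF p * (p / (1 + p ^ 2))) =
    2 * (2 * σu / (σu + σl) * (stdPDF p * (p / (1 + p ^ 2)))) := by ring
  rw [e2]
  simp only [wave]
  linarith

/-- With `U` replaced by its lower bound this is an equality, by `φ(2p) = exp(-3p²/2) φ(p)`. -/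
lemma errBound_le_mul {σl σu c t U : ℝ} (hσl : 0 < σl) (hσ : σl ≤ σu) (hc : 0 < c) (ht : 0 < t)
    (hU : 4 * σu / (σu + σl) *
      (stdPDF (c / √t / σu) * (c / √t / σu / (1 + (c / √t / σu) ^ 2))) ≤ U) :
    errBound σl σu c t ≤ (σu ^ 2 - σl ^ 2) * (c ^ 2 / σu ^ 2 + t) / (4 * c ^ 2) *
      Real.exp (-(3 * c ^ 2 / (2 * σu ^ 2 * t))) * U := by
  have hσu : 0 < σu := hσl.trans_le hσ
  have hq : 0 < √t := Real.sqrt_pos.2 ht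
  have h : 0 ≤ σu ^ 2 - σl ^ 2 := by
    have : σl ^ 2 ≤ σu ^ 2 := by gcongr
    linarith
  refine le_trans (le_of_eq ?_) (mul_le_mul_of_nonneg_left hU (by positivity))
  have e1 : stdPDF (2 * (c / √t / σu)) =
      Real.exp (-(3 * c ^ 2 / (2 * σu ^ 2 * t))) * stdPDF (c / √t / σu) := by
    rw [stdPDF_eq, stdPDF_eq, mul_left_comm, ← Real.exp_add]
    congr 2
    rw [mul_pow, div_pow, div_pow, Real.sq_sqrt ht.le]
    field_simp
    ring
  rw [errBound_eq hσu ht, e1]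
  generalize Real.exp (-(3 * c ^ 2 / (2 * σu ^ 2 * t))) = E
  generalize stdPDF (c / √t / σu) = φ
  have : t = √t ^ 2 := (Real.sq_sqrt ht.le).symm
  generalize √t = q at *
  subst this
  field_simp
  ring

/-! ### Initial data and conclusion -/

lemma continuousAt_indicator_lt_abs {c x : ℝ} (hx : |x| ≠ c) :
    ContinuousAt (indicator {y : ℝ | c < |y|} (1 : ℝ → ℝ)) x := by
  rcases lt_or_gt_of_ne hx with h | h
  · have : ∀ᶠ y in 𝓝 x, indicator {y : ℝ | c < |y|} (1 : ℝ → ℝ) y = 0 := by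
      filter_upwards [continuous_abs.continuousAt.eventually_lt continuousAt_const h] with y hy
      exact indicator_of_notMem (by simpa using hy.le) _
    exact (continuousAt_const (y := (0 : ℝ))).congr (this.mono fun y hy => hy.symm)
  · have : ∀ᶠ y in 𝓝 x, indicator {y : ℝ | c < |y|} (1 : ℝ → ℝ) y = 1 := by
      filter_upwards [continuousAt_const.eventually_lt continuous_abs.continuousAt h] with y hy
      exact indicator_of_mem (by simpa using hy) _
    exact (continuousAt_const (y := (1 : ℝ))).congr (this.mono fun y hy => hy.symm)

lemma tendsto_waves {σl σu c x : ℝ} (hσl : 0 < σl) (hσu : 0 < σu) (hc : 0 < c) (h1 : x ≠ c)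
    (h2 : x ≠ -c) :
    Tendsto (fun p => wave σl σu c 1 p + wave σl σu c (-1) p) (𝓝[Ioi 0 ×ˢ univ] ((0 : ℝ), x))
      (𝓝 (indicator {y : ℝ | c < |y|} (1 : ℝ → ℝ) x)) := by
  by_cases hx : c < |x|
  · rw [indicator_of_mem (by exact hx), Pi.one_apply]
    rcases lt_abs.1 hx with h | h
    · simpa using (tendsto_wave_one (e := 1) hσl hσu (by linarith)).add
        (tendsto_wave_zero (e := -1) hσl hσu (by linarith))
    · simpa using (tendsto_wave_zero (e := 1) hσl hσu (by linarith)).add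
        (tendsto_wave_one (e := -1) hσl hσu (by linarith))
  · rw [indicator_of_notMem (by exact hx)]
    obtain ⟨h3, h4⟩ := abs_le.1 (not_lt.1 hx)
    have h3 := lt_of_le_of_ne h3 h2.symm
    have h4 := lt_of_le_of_ne h4 h1
    simpa using (tendsto_wave_zero (e := 1) hσl hσu (by linarith)).add
        (tendsto_wave_zero (e := -1) hσl hσu (by linarith))

lemma waves_sub_mem_Icc {σl σu c : ℝ} (hσl : 0 < σl) (hσ : σl ≤ σu) (hc : 0 < c)
    {w : ℝ → ℝ → ℝ} (hw : IsSolution σl σu (indicator {y : ℝ | c < |y|} 1) w) {t x : ℝ}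
    (ht : 0 < t) :
    wave σl σu c 1 (t, x) + wave σl σu c (-1) (t, x) - w t x ∈ Icc 0 (errBound σl σu c t) := by
  have hσu : 0 < σu := hσl.trans_le hσ
  obtain ⟨M, hM⟩ := hw.bounded
  have hM0 : 0 ≤ M := (abs_nonneg _).trans (hM 0 0 le_rfl)
  have hp : ∀ e p, 0 < wave σl σu c e p := fun e p => profile_pos hσl hσu _
  have hp1 : ∀ e p, wave σl σu c e p ≤ 1 := fun e p => profile_le_one hσl hσu _
  have hlim : ∀ z : ℝ, z ≠ c → z ≠ -c → Tendsto (fun p : ℝ × ℝ =>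
      w p.1 p.2 - (wave σl σu c 1 p + wave σl σu c (-1) p))
      (𝓝[Ioi 0 ×ˢ univ] ((0 : ℝ), z)) (𝓝 0) := by
    intro z h1 h2
    have hz : |z| ≠ c := fun h => by
      rcases abs_choice z with h' | h' <;> rw [h'] at h
      exacts [h1 h, h2 (by linarith)]
    have h3 := (hw.initial_continuous z (continuousAt_indicator_lt_abs hz)).tendsto
    simp only [hw.initial] at h3
    have h4 := (h3.mono_left (nhdsWithin_mono _ (prod_mono Ioi_subset_Ici_self subset_rfl))).sub
      (tendsto_waves hσl hσu hc h1 h2)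
    rwa [sub_self] at h4
  constructor
  · have := le_of_isSubsolutionOf_of_ne (M := M + 1) (x₀ := x) (z₁ := c) (z₂ := -c) hσl hσ
      (G_add_le hσl.le hσ) (by linarith) hw.continuousOn hw.subsolution.isSubsolutionOf
      (P := fun p => wave σl σu c 1 p + wave σl σu c (-1) p)
      (fun p h => (wave_isSuperAt hσl hσu (by norm_num) h).add (G_add_le hσl.le hσ)
        (wave_isSuperAt hσl hσu (by norm_num) h))
      (fun s y hs => by
        linarith [le_abs_self (w s y), hM s y hs.le, hp 1 (s, y), hp (-1) (s, y)])
      (fun z ε h1 h2 hε => by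
        filter_upwards [(hlim z h1 h2).eventually (gt_mem_nhds hε)] with p h
        linarith) ht
    linarith
  · have := le_of_isSubsolutionOf_of_ne (M := M + 2) (x₀ := x) (z₁ := c) (z₂ := -c) hσl hσ
      -- The dual nonlinearity meets the perturbation condition because `G (-a) ≤ G (-(a + b)) + G
      -- b`.
      (F := fun a => -G σl σu (-a)) (fun a b => by
        have := G_add_le hσl.le hσ (-(a + b)) b
        rw [show -(a + b) + b = -a by ring] at this
        linarith) (by linarith) hw.continuousOn.neg hw.supersolution.isSubsolutionOf_neg
      (fun p h => errBound_sub_waves_isSuperAt hσl hσ hc h)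
      (fun s y hs => by
        have := errBound_nonneg hσ hc s
        linarith [neg_abs_le (w s y), hM s y hs.le, hp1 1 (s, y), hp1 (-1) (s, y)])
      (fun z ε h1 h2 hε => by
        filter_upwards [(hlim z h1 h2).eventually (lt_mem_nhds (neg_lt_zero.2 hε))] with p h
        linarith [errBound_nonneg hσ hc p.1]) ht
    linarith

end GHeat

theorem corollary3p3 (σl σu c : ℝ) (hσl : 0 < σl) (hσ : σl ≤ σu) (hc : σu / 2 < c)
    (w : ℝ → ℝ → ℝ)
    (hw : GHeat.IsSolution σl σu (Set.indicator {y : ℝ | c < |y|} 1) w) :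
    (∀ x : ℝ, GHeat.u σl σu c 0 x + GHeat.v σl σu c 0 x - w 0 x = 0) ∧
    ∀ t x : ℝ, 0 < t →
      (0 ≤ GHeat.u σl σu c t x + GHeat.v σl σu c t x - w t x ∧
        GHeat.u σl σu c t x + GHeat.v σl σu c t x - w t x ≤
          (σu - σl) * √t / (c * √(2 * Real.pi)) * Real.exp (-(2 * c ^ 2 / (σu ^ 2 * t)))) ∧
      0 < GHeat.u σl σu c t x + GHeat.v σl σu c t x ∧
      (0 ≤ (GHeat.u σl σu c t x + GHeat.v σl σu c t x - w t x) /
          (GHeat.u σl σu c t x + GHeat.v σl σu c t x) ∧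
        (GHeat.u σl σu c t x + GHeat.v σl σu c t x - w t x) /
          (GHeat.u σl σu c t x + GHeat.v σl σu c t x) ≤
          (σu ^ 2 - σl ^ 2) * (c ^ 2 / σu ^ 2 + t) / (4 * c ^ 2) *
            Real.exp (-(3 * c ^ 2 / (2 * σu ^ 2 * t)))) := by
  have hσu : 0 < σu := hσl.trans_le hσ
  have hc0 : 0 < c := by linarith
  refine ⟨fun x => ?_, fun t x ht => ?_⟩
  · rw [hw.initial]
    simp only [GHeat.u, GHeat.v, if_true, indicator_apply, mem_ofPred_eq, Pi.one_apply, lt_abs]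
    -- Positivity of `c` rules out `x > c` and `x < -c` holding together.
    split_ifs <;> first | (norm_num; done) | (exfalso; grind)
  · have hu : GHeat.u σl σu c t x = GHeat.wave σl σu c 1 (t, x) := by
      simp [GHeat.u, GHeat.wave, ht.ne']
    have hv : GHeat.v σl σu c t x = GHeat.wave σl σu c (-1) (t, x) := by
      simp [GHeat.v, GHeat.wave, ht.ne']
    rw [hu, hv]
    obtain ⟨h0, h1⟩ := GHeat.waves_sub_mem_Icc (x := x) hσl hσ hc0 hw ht
    have hpos : 0 < GHeat.wave σl σu c 1 (t, x) + GHeat.wave σl σu c (-1) (t, x) :=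
      add_pos (GHeat.profile_pos hσl hσu _) (GHeat.profile_pos hσl hσu _)
    refine ⟨⟨h0, h1⟩, hpos, div_nonneg h0 hpos.le, ?_⟩
    rw [div_le_iff₀ hpos]
    exact h1.trans (GHeat.errBound_le_mul hσl hσ hc0 ht (GHeat.le_wave_add_wave hσl hσ hc0 ht))
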